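/- Let $k$ be an algebraically closed field and let $\mathsf T$ be a $k$-linear triangulated category that is piecewise hereditary of tame domestic type, i.e. there is a $k$-linear triangle equivalence $\mathsf T\simeq \mathsf D^b(\mathrm{mod}\,kQ)$ for some quiver $Q$ without oriented cycles whose underlying graph is an extended simply-laced Dynkin diagram ($\tilde A_n$, $n\ge 1$; $\tilde D_n$, $n\ge 4$; $\tilde E_6,\tilde E_7,\tilde E_8$). Let $\mathscr T\subset\mathsf T$ be a standard stable tube of rank $\varrho>1$: the additive closure of a connected component of the Auslander–Reiten quiver of $\mathsf T$ that is isomorphic, as a translation quiver, to $\mathbb Z A_\infty/(\tau^\varrho)$ and such that the full subcategory of $\mathsf T$ on its (indecomposable) objects is equivalent to its mesh category. Such a tube is an abelian category in which every object has finite composition length; write $\ell(x)$ for the composition length of $x\in\mathscr T$ in the category $\mathscr T$. Let $(\mathsf X,\mathsf Y)$ be a t-structure on $\mathsf T$, that is, $\mathsf X,\mathsf Y$ are strictly full subcategories with $\Sigma\mathsf X\subseteq\mathsf X$, $\Sigma^{-1}\mathsf Y\subseteq\mathsf Y$, $\mathrm{Hom}_{\mathsf T}(\mathsf X,\mathsf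 Y)=0$, and every object $t$ of $\mathsf T$ fits into a distinguished triangle $t_{\mathsf X}\to t\to t_{\mathsf Y}\to\Sigma t_{\mathsf X}$ with $t_{\mathsf X}\in\mathsf X$ and $t_{\mathsf Y}\in\mathsf Y$. Assume that $\mathsf Y\cap\mathscr T$ contains infinitely many pairwise non-isomorphic indecomposable objects. Then for every indecomposable object $t\in\mathscr T$, every indecomposable direct summand $s$ of the left truncation $t_{\mathsf Y}$ that lies in $\mathscr T$ satisfies $$\ell(s)\;\le\;\varrho\,\Big\lceil \frac{\ell(t)}{\varrho}\Big\rceil .$$ -/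

import Mathlib

open CategoryTheory Limits

namespace LengthBound

/-! ### Quivers of extended simply-laced Dynkin type -/

/-- The extended (affine) simply-laced Dynkin diagrams: `A n`, `D n` stand for the extended diagrams
of types `A_(n+1)` and `D_(n+4)`, so that every extended diagram of type `A_m`, `m ≥ 1`, and
`D_m`, `m ≥ 4`, occurs. -/
inductive ExtendedDynkin : Type
  | A (n : ℕ)
  | D (n : ℕ)
  | E6
  | E7
  | E8

/-- The number of vertices. -/
def ExtendedDynkin.card : ExtendedDynkin → ℕ
  | A n => n + 2
  | D n => n + 5
  | E6 => 7
  | E7 => 8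
  | E8 => 9

/-- The list of edges; the vertices are numbered from `0` to `card - 1`. For `A n` this is the cycle
with `n + 2` vertices (a double edge if `n = 0`); for `D n` it is the path `2, …, n + 2` with two
further vertices attached at either end; `E6`, `E7`, `E8` are stars with centre `0` whose three arms
have `2, 2, 2`, respectively `1, 3, 3`, respectively `1, 2, 5` edges. -/
def ExtendedDynkin.edges : ExtendedDynkin → List (ℕ × ℕ)
  | A n => (List.range (n + 1)).map (fun i => (i, i + 1)) ++ [(n + 1, 0)]
  | D n => [(0, 2), (1, 2)] ++ (List.range n).map (fun i => (i + 2, i + 3)) ++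
      [(n + 2, n + 3), (n + 2, n + 4)]
  | E6 => [(0, 1), (1, 2), (0, 3), (3, 4), (0, 5), (5, 6)]
  | E7 => [(0, 1), (0, 2), (2, 3), (3, 4), (0, 5), (5, 6), (6, 7)]
  | E8 => [(0, 1), (0, 2), (2, 3), (0, 4), (4, 5), (5, 6), (6, 7), (7, 8)]

/-- An orientation of a diagram: `true` keeps the direction in which an edge is listed, `false`
reverses it. -/
abbrev ExtendedDynkin.Orientation (Δ : ExtendedDynkin) : Type := Fin Δ.edges.length → Bool

/-- The source and the target of the arrow belonging to an edge. -/
def ExtendedDynkin.endpoints (Δ : ExtendedDynkin) (o : Δ.Orientation)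
    (e : Fin Δ.edges.length) : ℕ × ℕ :=
  if o e then Δ.edges.get e else (Δ.edges.get e).swap

/-- The vertices of the quiver obtained from the diagram `Δ` by the orientation `o`. -/
structure DynkinVertex (Δ : ExtendedDynkin) (o : Δ.Orientation) : Type where
  idx : Fin Δ.card

/-- The quiver obtained from `Δ` by the orientation `o`: one arrow for every edge. -/
instance (Δ : ExtendedDynkin) (o : Δ.Orientation) : Quiver.{0} (DynkinVertex Δ o) where
  Hom a b := {e : Fin Δ.edges.length // Δ.endpoints o e = (a.idx.val, b.idx.val)}

/-- A quiver without oriented cycles. -/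
def IsAcyclicQuiver (V : Type) [Quiver.{0} V] : Prop :=
  ∀ (a : V) (p : Quiver.Path a a), p.length = 0

/-! ### Piecewise tame hereditary triangulated categories -/

universe u v w

/-- The category of finite-dimensional representations over `k` of a quiver `V`, equivalently (if `V`
has finitely many vertices) of finite-dimensional modules over its path algebra. -/
abbrev QuiverRep (k : Type u) [Field k] (V : Type) [Quiver.{0} V] : Type _ :=
  Paths V ⥤ FGModuleCat.{u} k

/-- A chosen derived category of the abelian category of representations. -/
noncomputable instance (k : Type u) [Field k] (V : Type) [Quiver.{0} V] :
    HasDerivedCategory (QuiverRep k V) :=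
  HasDerivedCategory.standard _

/-- The bounded derived category of finite-dimensional representations of `V`. -/
abbrev BoundedDerivedRep (k : Type u) [Field k] (V : Type) [Quiver.{0} V] : Type _ :=
  DerivedCategory.Bounded (QuiverRep k V)

variable {T : Type v} [Category.{w} T] [Preadditive T] [HasZeroObject T] [HasShift T ℤ]
  [∀ n : ℤ, (shiftFunctor T n).Additive] [Pretriangulated T]

/-- A `k`-linear triangulated category is piecewise hereditary of tame (domestic) type if it admits a
`k`-linear triangle equivalence to the bounded derived category of the path algebra of a quiver of
extended simply-laced Dynkin type (without oriented cycles). -/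
def IsPiecewiseTameHereditary (k : Type u) [Field k] (T : Type v) [Category.{w} T] [Preadditive T]
    [HasZeroObject T] [HasShift T ℤ] [∀ n : ℤ, (shiftFunctor T n).Additive] [Pretriangulated T]
    [Linear k T] : Prop :=
  ∃ (Δ : ExtendedDynkin) (o : Δ.Orientation), IsAcyclicQuiver (DynkinVertex Δ o) ∧
    ∃ (F : T ⥤ BoundedDerivedRep k (DynkinVertex Δ o)) (_ : F.CommShift ℤ),
      F.IsEquivalence ∧ F.IsTriangulated ∧ F.Linear k

/-! ### Auslander–Reiten triangles -/

/-- `x ⟶ e ⟶ z ⟶ x⟦1⟧` is an Auslander–Reiten triangle: it is distinguished, its end terms are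
indecomposable, its connecting morphism is non-zero, and every morphism to `z` that is not a split
epimorphism factors through `e ⟶ z`. -/
structure IsARTriangle {x e z : T} (f : x ⟶ e) (g : e ⟶ z) (h : z ⟶ x⟦(1 : ℤ)⟧) : Prop where
  distinguished : Pretriangulated.Triangle.mk f g h ∈ Pretriangulated.distinguishedTriangles
  indecomposable_left : Indecomposable x
  indecomposable_right : Indecomposable z
  connecting_ne_zero : h ≠ 0
  factors : ∀ ⦃w : T⦄ (a : w ⟶ z), ¬ IsSplitEpi a → ∃ b : w ⟶ e, b ≫ g = a

/-! ### Standard stable tubes -/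

/-- The vertices of the stable translation quiver `ℤA_∞/(τ^r)`: the vertex `⟨i, l⟩` lies on the
`i`-th ray, at height `l` above the mouth `l = 0`. -/
@[ext]
structure TubeVertex (r : ℕ) : Type where
  ray : ZMod r
  level : ℕ

/-- The arrows of `ℤA_∞/(τ^r)`. -/
inductive TubeArrow (r : ℕ) : TubeVertex r → TubeVertex r → Type
  | up (i : ZMod r) (l : ℕ) : TubeArrow r ⟨i, l⟩ ⟨i, l + 1⟩
  | down (i : ZMod r) (l : ℕ) : TubeArrow r ⟨i, l + 1⟩ ⟨i + 1, l⟩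

instance (r : ℕ) : Quiver.{0} (TubeVertex r) where
  Hom := TubeArrow r

/-- The inverse translation `τ⁻¹` of `ℤA_∞/(τ^r)`. -/
def TubeVertex.invTranslate {r : ℕ} (x : TubeVertex r) : TubeVertex r := ⟨x.ray + 1, x.level⟩

/-- The path from `⟨i, l⟩` to `τ⁻¹⟨i, l⟩` through `⟨i, l + 1⟩`. -/
def upDown {r : ℕ} (i : ZMod r) (l : ℕ) :
    Quiver.Path (⟨i, l⟩ : TubeVertex r) (TubeVertex.invTranslate ⟨i, l⟩) :=
  Quiver.Path.cons (Quiver.Path.cons Quiver.Path.nil (TubeArrow.up i l)) (TubeArrow.down i l)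

/-- The path from `⟨i, l + 1⟩` to `τ⁻¹⟨i, l + 1⟩` through `⟨i + 1, l⟩`. -/
def downUp {r : ℕ} (i : ZMod r) (l : ℕ) :
    Quiver.Path (⟨i, l + 1⟩ : TubeVertex r) (TubeVertex.invTranslate ⟨i, l + 1⟩) :=
  Quiver.Path.cons (Quiver.Path.cons Quiver.Path.nil (TubeArrow.down i l)) (TubeArrow.up (i + 1) l)

/-- The mesh relation starting in `x`: the sum of all paths of length two from `x` to `τ⁻¹ x`. -/
noncomputable def meshRelation (k : Type u) [Field k] {r : ℕ} :
    (x : TubeVertex r) → (Quiver.Path x x.invTranslate →₀ k)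
  | ⟨i, 0⟩ => Finsupp.single (upDown i 0) 1
  | ⟨i, l + 1⟩ => Finsupp.single (upDown i (l + 1)) 1 + Finsupp.single (downUp i l) 1

/-- The mesh ideal of the `k`-linear path category of `ℤA_∞/(τ^r)`: the two-sided ideal generated by
the mesh relations. The mesh category is the path category modulo this ideal. -/
noncomputable def meshIdeal (k : Type u) [Field k] {r : ℕ} (x y : TubeVertex r) :
    Submodule k (Quiver.Path x y →₀ k) :=
  Submodule.span k {c | ∃ (z : TubeVertex r) (p : Quiver.Path x z) (q : Quiver.Path z.invTranslate y),
    c = (meshRelation k z).mapDomain (fun m => (p.comp m).comp q)}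

/-- The action on morphisms of the `k`-linear functor from the path category of `ℤA_∞/(τ^r)` to `T`
determined by a diagram `φ`. -/
noncomputable def evalPaths (k : Type u) [Field k] [Linear k T] {r : ℕ} (φ : TubeVertex r ⥤q T)
    (x y : TubeVertex r) : (Quiver.Path x y →₀ k) →ₗ[k] (φ.obj x ⟶ φ.obj y) :=
  Finsupp.linearCombination k (fun p : Quiver.Path x y => (Paths.lift φ).map p)

/-- The middle term of the Auslander–Reiten triangle starting in `x`, as prescribed by the
translation quiver `ℤA_∞/(τ^r)`: the direct sum of the targets of the arrows starting in `x`. -/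
noncomputable def meshMiddle {r : ℕ} (φ : TubeVertex r → T) : TubeVertex r → T
  | ⟨i, 0⟩ => φ ⟨i, 1⟩
  | ⟨i, l + 1⟩ => φ ⟨i, l + 2⟩ ⊞ φ ⟨i + 1, l⟩

/-- The data exhibiting a full subcategory `P` of `T` as a standard stable tube of rank `r`: `P` is the
additive closure (`mem_iff`) of a connected component of the Auslander–Reiten quiver of `T` which, as
a translation quiver, is isomorphic to `ℤA_∞/(τ^r)` and which is standard. The vertices of the
component are the objects `φ.obj x` (`indecomposable`, `injective`). The Auslander–Reiten triangles
(`arTriangle`) give the translation, and the summands of their middle terms give all arrows of the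
Auslander–Reiten quiver of `T` that start or end in the component. Standard means that the full
subcategory of `T` on these objects is equivalent to the mesh category: the `k`-linear functor from
the path category determined by `φ` is surjective on morphisms (`full`) and its kernel is the mesh
ideal (`kernel`). -/
structure TubeData (k : Type u) [Field k] [Linear k T] (P : ObjectProperty T) (r : ℕ) where
  rank_pos : 0 < r
  φ : TubeVertex r ⥤q T
  indecomposable : ∀ x, Indecomposable (φ.obj x)
  injective : ∀ x y, Nonempty (φ.obj x ≅ φ.obj y) → x = y
  arTriangle : ∀ x, ∃ (f : φ.obj x ⟶ meshMiddle φ.obj x)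
    (g : meshMiddle φ.obj x ⟶ φ.obj x.invTranslate)
    (h : φ.obj x.invTranslate ⟶ (φ.obj x)⟦(1 : ℤ)⟧), IsARTriangle f g h
  full : ∀ x y, Function.Surjective (evalPaths k φ x y)
  kernel : ∀ x y, LinearMap.ker (evalPaths k φ x y) = meshIdeal k x y
  mem_iff : ∀ X : T, P X ↔ ∃ (n : ℕ) (a : Fin n → TubeVertex r),
    Nonempty (X ≅ ⨁ fun j => φ.obj (a j))

/-- `P` is a standard stable tube of rank `r` in `T`. -/
def IsStandardStableTube (k : Type u) [Field k] [Linear k T] (P : ObjectProperty T) (r : ℕ) : Prop :=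
  Nonempty (TubeData k P r)

/-! ### Length -/

/-- The (composition) length of an object: the supremum of the lengths of chains of subobjects. -/
noncomputable def objLength {C : Type v} [Category.{w} C] (X : C) : ℕ∞ :=
  Order.height (⊤ : Subobject X)

/-- The composition length of an object of the tube `P`, taken in the category `P` itself (where
subobjects are represented by morphisms of `P` that are monomorphisms in `P`). -/
noncomputable def tubeLength (P : ObjectProperty T) (X : T) (hX : P X) : ℕ∞ :=
  objLength (⟨X, hX⟩ : P.FullSubcategory)

/-- The isomorphism classes of indecomposable objects with the property `P`. -/
def ind (P : ObjectProperty T) : Set (Quotient (isIsomorphicSetoid T)) :=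
  {c | ∃ X : T, Indecomposable X ∧ P X ∧ Quotient.mk (isIsomorphicSetoid T) X = c}

end LengthBound

/-! The bound comes from comparing dimensions of morphism spaces. A morphism from `tY` to an object
of the co-aisle that vanishes on `t` factors through the shift of `tX`, hence is zero
(`eq_zero_of_truncation_comp`). Precomposition with `t ⟶ tY ⟶ s` therefore embeds `End(s)` into
`Hom(t, s)`.

In a standard tube of rank `r` these spaces are computed in the mesh category. Up to sign a path
depends only on its end points and its number `a` of downward steps, and it vanishes once `a`
exceeds the level of its source. Moreover `a` is determined modulo `r` by the rays of the end
points. Hence `dim Hom(x, y) ≤ ⌊x.level / r⌋ + 1` (`finrank_hom_le`), while the closed paths with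
`0, r, 2r, …` downward steps give `dim End(y) ≥ ⌊y.level / r⌋ + 1` (`le_finrank_end`). Linear
independence is detected by signed path counts that annihilate the mesh ideal
(`meshIdeal_le_ker_pathCoeff`).

The object at level `l` has length `l + 1` (`objLength_tubeObj`), since its non-zero subobjects are
the objects on its ray up to level `l`. As `⌊l / r⌋ + 1 = ⌈(l + 1) / r⌉`, the embedding says `⌈ℓ(s)
/ r⌉ ≤ ⌈ℓ(t) / r⌉`, which is the assertion. -/

namespace LengthBound

universe u v w

/-! ### Paths in the translation quiver of a tube -/

section Paths

variable {r : ℕ}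

/-- The number of downward steps of an arrow. -/
def TubeArrow.downs : ∀ {x y : TubeVertex r}, TubeArrow r x y → ℕ
  | _, _, .up _ _ => 0
  | _, _, .down _ _ => 1

/-- The number of upward steps of an arrow. -/
def TubeArrow.ups : ∀ {x y : TubeVertex r}, TubeArrow r x y → ℕ
  | _, _, .up _ _ => 1
  | _, _, .down _ _ => 0

/-- The sign by which the mesh category differs from the commutative one on an arrow. -/
def TubeArrow.sign : ∀ {x y : TubeVertex r}, TubeArrow r x y → ℤ
  | _, _, .up _ _ => 1
  | _, _, .down _ l => (-1) ^ l

/-- The number of downward steps of a path. -/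
def downs {x : TubeVertex r} : ∀ {y : TubeVertex r}, Quiver.Path x y → ℕ
  | _, .nil => 0
  | _, .cons p e => downs p + TubeArrow.downs e

/-- The number of upward steps of a path. -/
def ups {x : TubeVertex r} : ∀ {y : TubeVertex r}, Quiver.Path x y → ℕ
  | _, .nil => 0
  | _, .cons p e => ups p + TubeArrow.ups e

/-- The product of the signs of the arrows of a path. -/
def pathSign {x : TubeVertex r} : ∀ {y : TubeVertex r}, Quiver.Path x y → ℤ
  | _, .nil => 1
  | _, .cons p e => pathSign p * TubeArrow.sign e

lemma downs_comp {x y : TubeVertex r} (p : Quiver.Path x y) :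
    ∀ {z : TubeVertex r} (q : Quiver.Path y z), downs (p.comp q) = downs p + downs q
  | _, .nil => rfl
  | _, .cons q e => by simp [downs, downs_comp p q, add_assoc]

lemma pathSign_comp {x y : TubeVertex r} (p : Quiver.Path x y) :
    ∀ {z : TubeVertex r} (q : Quiver.Path y z), pathSign (p.comp q) = pathSign p * pathSign q
  | _, .nil => by simp [pathSign]
  | _, .cons q e => by simp [pathSign, pathSign_comp p q, mul_assoc]

lemma pathSign_mul_self {x : TubeVertex r} :
    ∀ {y : TubeVertex r} (p : Quiver.Path x y), pathSign p * pathSign p = 1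
  | _, .nil => by simp [pathSign]
  | _, .cons p e => by
    have h : TubeArrow.sign e * TubeArrow.sign e = 1 := by
      change TubeArrow r _ _ at e
      cases e <;> simp [TubeArrow.sign, ← mul_pow]
    calc _ = (pathSign p * pathSign p) * (TubeArrow.sign e * TubeArrow.sign e) := by
            simp only [pathSign]; ring
      _ = 1 := by rw [pathSign_mul_self p, h, one_mul]

lemma level_add_downs {x : TubeVertex r} :
    ∀ {y : TubeVertex r} (p : Quiver.Path x y), y.level + downs p = x.level + ups p
  | _, .nil => rfl
  | _, .cons p e => by
    have := level_add_downs p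
    change TubeArrow r _ _ at e
    cases e <;> simp_all [downs, ups, TubeArrow.downs, TubeArrow.ups] <;> omega

lemma ray_eq_add_downs {x : TubeVertex r} :
    ∀ {y : TubeVertex r} (p : Quiver.Path x y), y.ray = x.ray + (downs p : ZMod r)
  | _, .nil => by simp [downs]
  | _, .cons p e => by
    have := ray_eq_add_downs p
    change TubeArrow r _ _ at e
    cases e <;> simp_all [downs, TubeArrow.downs, add_assoc]

/-- `IsNormalPath a b y p`: the path `p` to `y` consists of `a` downward steps followed by `b` upward
steps. -/
inductive IsNormalPath (x : TubeVertex r) :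
    ℕ → ℕ → ∀ y : TubeVertex r, Quiver.Path x y → Prop
  | nil : IsNormalPath x 0 0 x .nil
  | down {a : ℕ} {i : ZMod r} {l : ℕ} {p : Quiver.Path x ⟨i, l + 1⟩}
      (hp : IsNormalPath x a 0 ⟨i, l + 1⟩ p) :
      IsNormalPath x (a + 1) 0 ⟨i + 1, l⟩ (p.cons (TubeArrow.down i l))
  | up {a b : ℕ} {i : ZMod r} {l : ℕ} {p : Quiver.Path x ⟨i, l⟩}
      (hp : IsNormalPath x a b ⟨i, l⟩ p) :
      IsNormalPath x a (b + 1) ⟨i, l + 1⟩ (p.cons (TubeArrow.up i l))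

namespace IsNormalPath

variable {x y y' : TubeVertex r} {a b : ℕ} {p : Quiver.Path x y} {q : Quiver.Path x y'}

/-- The end points are kept independent and the paths compared by `≍` so that the induction can
strip the last arrow from both paths. -/
lemma unique (hp : IsNormalPath x a b y p) (hq : IsNormalPath x a b y' q) : y = y' ∧ p ≍ q := by
  induction hp generalizing y' with
  | nil => cases hq; exact ⟨rfl, HEq.rfl⟩
  | down _ ih =>
    cases hq with
    | down hq =>
      obtain ⟨h, h'⟩ := ih hq
      simp only [TubeVertex.mk.injEq, add_left_inj] at h
      obtain ⟨rfl, rfl⟩ := h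
      obtain rfl := eq_of_heq h'
      exact ⟨rfl, HEq.rfl⟩
  | up _ ih =>
    cases hq with
    | up hq =>
      obtain ⟨h, h'⟩ := ih hq
      simp only [TubeVertex.mk.injEq] at h
      obtain ⟨rfl, rfl⟩ := h
      obtain rfl := eq_of_heq h'
      exact ⟨rfl, HEq.rfl⟩

lemma downs_eq (hp : IsNormalPath x a b y p) : downs p = a := by
  induction hp <;> simp_all [downs, TubeArrow.downs]

lemma ups_eq (hp : IsNormalPath x a b y p) : ups p = b := by
  induction hp <;> simp_all [ups, TubeArrow.ups]

/-- All downward steps precede the upward ones, so they must fit between the level of `x` and the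
mouth. -/
lemma downs_le (hp : IsNormalPath x a b y p) : a ≤ x.level := by
  have : a + y.level = x.level + b ∧ b ≤ y.level := by
    induction hp <;> grind
  omega

lemma exists_path (x : TubeVertex r) (a b : ℕ) (ha : a ≤ x.level) :
    ∃ p, IsNormalPath x a b ⟨x.ray + a, x.level - a + b⟩ p := by
  induction b with
  | zero =>
    induction a with
    | zero =>
      rw [Nat.cast_zero, add_zero]
      exact ⟨_, .nil⟩
    | succ a ih =>
      obtain ⟨p, hp⟩ := ih (by omega)
      obtain ⟨c, hc⟩ : ∃ c, x.level = a + c + 1 := ⟨x.level - a - 1, by omega⟩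
      have h₁ : x.level - a + 0 = c + 1 := by omega
      have h₂ : x.level - (a + 1) + 0 = c := by omega
      rw [h₂, Nat.cast_succ, ← add_assoc]
      revert p
      rw [h₁]
      exact fun p hp => ⟨_, hp.down⟩
  | succ b ih =>
    obtain ⟨p, hp⟩ := ih
    exact ⟨_, hp.up⟩

lemma eq_of_downs_eq {a' b' : ℕ} {q : Quiver.Path x y} (hp : IsNormalPath x a b y p)
    (hq : IsNormalPath x a' b' y q) (h : a = a') : p = q := by
  subst h
  have h₁ := level_add_downs p
  have h₂ := level_add_downs q
  rw [hp.downs_eq, hp.ups_eq] at h₁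
  rw [hq.downs_eq, hq.ups_eq] at h₂
  obtain rfl : b = b' := by omega
  exact eq_of_heq (hp.unique hq).2

end IsNormalPath

end Paths

/-! ### Coefficients of morphisms in the mesh category -/

section Coefficients

variable (k : Type u) [Field k] {r : ℕ}

/-- The signed number of paths with `a` downward steps in a linear combination of paths starting in
`x`; it is set to zero if `a` exceeds the level of `x`. -/
noncomputable def pathCoeff (a : ℕ) (x y : TubeVertex r) : (Quiver.Path x y →₀ k) →ₗ[k] k :=
  Finsupp.linearCombination k
    (fun p : Quiver.Path x y => if downs p = a ∧ a ≤ x.level then (pathSign p : k) else 0)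

lemma pathCoeff_single (a : ℕ) {x y : TubeVertex r} (p : Quiver.Path x y) (c : k) :
    pathCoeff k a x y (Finsupp.single p c) =
      c * if downs p = a ∧ a ≤ x.level then (pathSign p : k) else 0 := by
  simp [pathCoeff]

/-- At a vertex above the mouth, the two paths of the mesh have equally many downward steps and
opposite signs, so their contributions cancel. A path through the mesh of a mouth vertex must first
descend to the mouth and then go down once more, so it has more than `x.level` downward steps and
the cutoff discards it. -/
lemma meshIdeal_le_ker_pathCoeff (a : ℕ) (x y : TubeVertex r) :
    meshIdeal k x y ≤ LinearMap.ker (pathCoeff k a x y) := by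
  rw [meshIdeal, Submodule.span_le]
  rintro _ ⟨⟨i, l⟩, p, q, rfl⟩
  have hp := level_add_downs p
  cases l with
  | zero =>
    have h : ¬ (downs ((p.comp (upDown i 0)).comp q) = a ∧ a ≤ x.level) := by
      simp only [downs_comp, upDown, downs, TubeArrow.downs] at hp ⊢
      omega
    simp only [meshRelation, Finsupp.mapDomain_single, SetLike.mem_coe, LinearMap.mem_ker]
    rw [pathCoeff_single, if_neg h, mul_zero]
  | succ l =>
    have h₁ : downs ((p.comp (upDown i (l + 1))).comp q) =
        downs ((p.comp (downUp i l)).comp q) := by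
      simp [downs_comp, upDown, downUp, downs, TubeArrow.downs]
    have h₂ : pathSign ((p.comp (upDown i (l + 1))).comp q) =
        - pathSign ((p.comp (downUp i l)).comp q) := by
      simp [pathSign_comp, upDown, downUp, pathSign, TubeArrow.sign, pow_succ]
    simp only [meshRelation, Finsupp.mapDomain_add, Finsupp.mapDomain_single, SetLike.mem_coe,
      LinearMap.mem_ker, map_add]
    erw [pathCoeff_single, pathCoeff_single, h₁, h₂]
    split_ifs <;> simp

variable {T : Type v} [Category.{w} T] [Preadditive T] [HasZeroObject T] [HasShift T ℤ]
  [∀ n : ℤ, (shiftFunctor T n).Additive] [Pretriangulated T]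
variable {k} [Linear k T] {P : ObjectProperty T} (D : TubeData k P r)

namespace TubeData

/-- The morphism of a tube given by a path. -/
def ofPath {x y : TubeVertex r} (p : Quiver.Path x y) : D.φ.obj x ⟶ D.φ.obj y :=
  (Paths.lift D.φ).map p

lemma ofPath_nil (x : TubeVertex r) : D.ofPath (.nil : Quiver.Path x x) = 𝟙 _ := rfl

lemma ofPath_cons {x y z : TubeVertex r} (p : Quiver.Path x y) (e : y ⟶ z) :
    D.ofPath (p.cons e) = D.ofPath p ≫ D.φ.map e := rfl

lemma ofPath_comp {x y z : TubeVertex r} (p : Quiver.Path x y) (q : Quiver.Path y z) :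
    D.ofPath (p.comp q) = D.ofPath p ≫ D.ofPath q :=
  (Paths.lift D.φ).map_comp p q

lemma evalPaths_single {x y : TubeVertex r} (p : Quiver.Path x y) :
    evalPaths k D.φ x y (Finsupp.single p 1) = D.ofPath p :=
  (Finsupp.linearCombination_single k _ _).trans (one_smul k _)

lemma evalPaths_meshRelation (z : TubeVertex r) :
    evalPaths k D.φ _ _ (meshRelation k z) = 0 := by
  rw [← LinearMap.mem_ker, D.kernel]
  refine Submodule.subset_span ⟨z, .nil, .nil, ?_⟩
  have : (fun m : Quiver.Path z z.invTranslate =>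
      ((Quiver.Path.nil : Quiver.Path z z).comp m).comp .nil) = id := by
    funext m; simp
  rw [this, Finsupp.mapDomain_id]

lemma up_comp_down_zero (i : ZMod r) :
    D.φ.map (TubeArrow.up i 0) ≫ D.φ.map (TubeArrow.down i 0) = 0 := by
  have h := D.evalPaths_meshRelation ⟨i, 0⟩
  rw [meshRelation, evalPaths_single] at h
  have h' : (𝟙 (D.φ.obj ⟨i, 0⟩) ≫ D.φ.map (TubeArrow.up i 0)) ≫ D.φ.map (TubeArrow.down i 0) = 0 :=
    h
  rwa [Category.id_comp] at h'

lemma up_comp_down (i : ZMod r) (l : ℕ) :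
    D.φ.map (TubeArrow.up i (l + 1)) ≫ D.φ.map (TubeArrow.down i (l + 1)) =
      - (D.φ.map (TubeArrow.down i l) ≫ D.φ.map (TubeArrow.up (i + 1) l)) := by
  have h := D.evalPaths_meshRelation ⟨i, l + 1⟩
  rw [meshRelation, map_add, evalPaths_single] at h
  erw [evalPaths_single] at h
  have h' : (𝟙 (D.φ.obj ⟨i, l + 1⟩) ≫ D.φ.map (TubeArrow.up i (l + 1))) ≫
      D.φ.map (TubeArrow.down i (l + 1)) + (𝟙 (D.φ.obj ⟨i, l + 1⟩) ≫
      D.φ.map (TubeArrow.down i l)) ≫ D.φ.map (TubeArrow.up (i + 1) l) = 0 := h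
  rw [Category.id_comp, Category.id_comp] at h'
  exact eq_neg_of_add_eq_zero_left h'

/-- Two linear maps on a morphism space of a tube agree if they agree on paths. -/
lemma hom_ext {x y : TubeVertex r} {M : Type*} [AddCommGroup M] [Module k M]
    {f g : (D.φ.obj x ⟶ D.φ.obj y) →ₗ[k] M} (h : ∀ p, f (D.ofPath p) = g (D.ofPath p)) : f = g := by
  have : f ∘ₗ evalPaths k D.φ x y = g ∘ₗ evalPaths k D.φ x y := by
    refine Finsupp.lhom_ext' fun p => LinearMap.ext_ring ?_
    simpa [evalPaths_single] using h p
  ext a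
  obtain ⟨c, rfl⟩ := D.full x y a
  exact LinearMap.congr_fun this c

/-- The coefficient of a morphism of a tube at the normal path with `a` downward steps. -/
noncomputable def coeff (a : ℕ) {x y : TubeVertex r} : (D.φ.obj x ⟶ D.φ.obj y) →ₗ[k] k :=
  (LinearMap.ker (evalPaths k D.φ x y)).liftQ (pathCoeff k a x y)
    ((D.kernel x y).trans_le (meshIdeal_le_ker_pathCoeff k a x y)) ∘ₗ
  ((evalPaths k D.φ x y).quotKerEquivOfSurjective (D.full x y)).symm.toLinearMap

lemma coeff_ofPath (a : ℕ) {x y : TubeVertex r} (p : Quiver.Path x y) :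
    D.coeff a (D.ofPath p) = if downs p = a ∧ a ≤ x.level then (pathSign p : k) else 0 := by
  have h : ((evalPaths k D.φ x y).quotKerEquivOfSurjective (D.full x y)).symm (D.ofPath p) =
      Submodule.Quotient.mk (Finsupp.single p 1) := by
    rw [LinearEquiv.symm_apply_eq, ← evalPaths_single]
    rfl
  simp only [coeff, LinearMap.comp_apply, LinearEquiv.coe_coe, h]
  erw [Submodule.liftQ_apply]
  rw [pathCoeff_single, one_mul]

/-- The mesh relations move the new downward arrow to the left past the upward arrows, with a change
of sign each time. It either joins the initial descent or meets an upward arrow starting at the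
mouth, where the product is zero. The equation `hy` keeps the end vertex a variable for the
induction. -/
lemma normalPath_comp_down {x y : TubeVertex r} {a b : ℕ} {p : Quiver.Path x y}
    (hp : IsNormalPath x a b y p) (i : ZMod r) (l : ℕ) (hy : y = ⟨i, l + 1⟩) :
    (x.level ≤ a ∧ D.ofPath p ≫ eqToHom (by rw [hy]) ≫ D.φ.map (TubeArrow.down i l) = 0) ∨
    ∃ (b' : ℕ) (q : Quiver.Path x ⟨i + 1, l⟩) (c : k), IsNormalPath x (a + 1) b' _ q ∧
      D.ofPath p ≫ eqToHom (by rw [hy]) ≫ D.φ.map (TubeArrow.down i l) = c • D.ofPath q := by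
  induction hp generalizing i l with
  | nil =>
    subst hy
    exact .inr ⟨_, _, 1, .down .nil, by simp [ofPath_cons, ofPath_nil]⟩
  | down hp _ =>
    rename_i i₀ l₀ p₀
    simp only [TubeVertex.mk.injEq] at hy
    obtain ⟨rfl, rfl⟩ := hy
    exact .inr ⟨_, _, 1, .down (.down hp), by simp [ofPath_cons]⟩
  | up hp ih =>
    rename_i a₀ b₀ i₀ l₀ p₀
    simp only [TubeVertex.mk.injEq, add_left_inj] at hy
    obtain ⟨rfl, rfl⟩ := hy
    cases l₀ with
    | zero =>
      have h := level_add_downs p₀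
      rw [hp.downs_eq] at h
      refine .inl ⟨?_, ?_⟩
      · simp only at h
        omega
      · simp [ofPath_cons, up_comp_down_zero]
    | succ l =>
      rcases ih _ _ rfl with ⟨h₁, h₂⟩ | ⟨b', q, c, hq, h⟩
      · refine .inl ⟨h₁, ?_⟩
        simp only [eqToHom_refl, Category.id_comp] at h₂
        simp [ofPath_cons, up_comp_down, reassoc_of% h₂]
      · refine .inr ⟨_, _, -c, hq.up, ?_⟩
        simp only [eqToHom_refl, Category.id_comp] at h
        simp [ofPath_cons, up_comp_down, reassoc_of% h]

/-- Every path is in the mesh category a multiple of a normal path or zero. -/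
lemma ofPath_eq_smul_normalPath {x y : TubeVertex r} (p : Quiver.Path x y) :
    (x.level < downs p ∧ D.ofPath p = 0) ∨
    ∃ (b : ℕ) (q : Quiver.Path x y) (c : k), IsNormalPath x (downs p) b _ q ∧
      D.ofPath p = c • D.ofPath q := by
  induction p with
  | nil => exact .inr ⟨_, _, 1, .nil, by simp⟩
  | cons p e ih =>
    rcases ih with ⟨h₁, h₂⟩ | ⟨b, q, c, hq, h⟩
    · refine .inl ⟨by simp only [downs]; omega, by rw [ofPath_cons, h₂, zero_comp]⟩
    · change TubeArrow r _ _ at e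
      cases e with
      | up i l => exact .inr ⟨_, _, c, hq.up, by simp [ofPath_cons, h]⟩
      | down i l =>
        rcases D.normalPath_comp_down hq i l rfl with ⟨h₁, h₂⟩ | ⟨b', q', c', hq', h'⟩
        · refine .inl ⟨by simp only [downs, TubeArrow.downs]; omega, ?_⟩
          simp only [eqToHom_refl, Category.id_comp] at h₂
          simp [ofPath_cons, h, h₂]
        · refine .inr ⟨_, _, c * c', hq', ?_⟩
          simp only [eqToHom_refl, Category.id_comp] at h'
          simp [ofPath_cons, h, h', mul_smul]

/-- A morphism of a tube is determined by its coefficients. -/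
lemma eq_zero_of_coeff {x y : TubeVertex r} (f : D.φ.obj x ⟶ D.φ.obj y)
    (hf : ∀ a ≤ x.level, D.coeff a f = 0) : f = 0 := by
  classical
  -- The signed normal path with `a` downward steps is dual to `D.coeff a`; where no such path
  -- exists the value is zero.
  let θ (a : ℕ) : D.φ.obj x ⟶ D.φ.obj y :=
    if h : ∃ b q, IsNormalPath x a b y q then
      (pathSign h.choose_spec.choose : k) • D.ofPath h.choose_spec.choose else 0
  -- The expansion of a morphism in normal paths, which only has to be checked on paths.
  have hid : LinearMap.id = ∑ a ∈ Finset.range (x.level + 1),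
      (D.coeff a (x := x) (y := y)).smulRight (θ a) := by
    refine D.hom_ext fun p => ?_
    simp only [LinearMap.id_apply, LinearMap.sum_apply, LinearMap.smulRight_apply]
    have hc : ∀ a, D.coeff a (D.ofPath p) =
        if downs p = a ∧ a ≤ x.level then (pathSign p : k) else 0 := fun a => D.coeff_ofPath a p
    rcases D.ofPath_eq_smul_normalPath p with ⟨h₁, h₂⟩ | ⟨b, q, c, hq, h⟩
    · rw [h₂]; simp
    · have hle := hq.downs_le
      rw [Finset.sum_eq_single_of_mem (downs p) (by simp; omega)
        (fun a _ ha => by rw [hc, if_neg (fun h => ha h.1.symm), zero_smul])]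
      have hex : ∃ b q, IsNormalPath x (downs p) b y q := ⟨b, q, hq⟩
      have hθ : θ (downs p) = (pathSign q : k) • D.ofPath q := by
        simp only [θ, dif_pos hex]
        rw [hex.choose_spec.choose_spec.eq_of_downs_eq hq rfl]
      have hcq := D.coeff_ofPath (downs p) q
      rw [hq.downs_eq, if_pos ⟨rfl, hle⟩] at hcq
      have hs : (pathSign q : k) * pathSign q = 1 := by
        exact_mod_cast congrArg (Int.cast : ℤ → k) (pathSign_mul_self q)
      rw [hθ, h, map_smul, hcq, smul_eq_mul, smul_smul, mul_assoc, hs, mul_one]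
  rw [← LinearMap.id_apply (R := k) f, hid, LinearMap.sum_apply]
  exact Finset.sum_eq_zero fun a ha => by
    rw [LinearMap.smulRight_apply, hf a (by simp at ha; omega), zero_smul]

/-- Only downward steps change the ray, and the number of upward steps `y.level + a - x.level`
cannot be negative. -/
lemma coeff_eq_zero {x y : TubeVertex r} (f : D.φ.obj x ⟶ D.φ.obj y) {a : ℕ}
    (h : ¬ (y.ray = x.ray + a ∧ x.level ≤ y.level + a)) : D.coeff a f = 0 := by
  have : D.coeff a (x := x) (y := y) = 0 := by
    refine D.hom_ext fun p => ?_
    rw [coeff_ofPath, LinearMap.zero_apply, if_neg]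
    rintro ⟨rfl, -⟩
    have := level_add_downs p
    exact h ⟨ray_eq_add_downs p, by omega⟩
  rw [this, LinearMap.zero_apply]

end TubeData

end Coefficients

/-! ### Composition length -/

section Length

variable {C : Type v} [Category.{w} C]

lemma objLength_eq_of_iso {X Y : C} (e : X ≅ Y) : objLength X = objLength Y := by
  rw [objLength, objLength, ← map_top (Subobject.mapIsoToOrderIso e), Order.height_orderIso]

/-- The subobjects of the underlying object of `S` form the interval below `S`. -/
lemma objLength_underlying {X : C} (S : Subobject X) : objLength (S : C) = Order.height S := by
  have h := Order.height_eq_krullDim_Iic S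
  rw [← Order.height_top_eq_krullDim, ← map_top (Subobject.subobjectOrderIso S),
    Order.height_orderIso] at h
  exact_mod_cast h.symm

lemma objLength_add_one_le {X Y : C} (f : X ⟶ Y) [Mono f] (hf : ¬ IsIso f) :
    objLength X + 1 ≤ objLength Y := by
  rw [objLength_eq_of_iso (Subobject.underlyingIso f).symm, objLength_underlying]
  exact Order.height_add_one_le
    (lt_of_le_of_ne le_top fun h => hf ((Subobject.isIso_iff_mk_eq_top f).2 h))

lemma objLength_le {X : C} (n : ℕ)
    (h : ∀ (Y : C) (f : Y ⟶ X) [Mono f], ¬ IsIso f → objLength Y < n) : objLength X ≤ n := by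
  rw [objLength, Order.height_le_coe_iff]
  intro S hS
  rw [← objLength_underlying]
  exact h _ S.arrow fun hS' => hS.ne ((Subobject.isIso_arrow_iff_eq_top S).1 hS')

lemma objLength_eq_zero_of_isZero {X : C} [HasZeroMorphisms C] (hX : IsZero X) :
    objLength X = 0 := by
  refine nonpos_iff_eq_zero.1 (objLength_le 0 fun Y f _ hf => (hf ?_).elim)
  have : f ≫ (0 : X ⟶ Y) = 𝟙 Y := by
    rw [← cancel_mono f]
    exact hX.eq_of_tgt _ _
  exact ⟨0, this, hX.eq_of_tgt _ _⟩

end Length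

/-! ### Decomposing finite biproducts -/

lemma nonempty_iso_biproduct_succ {C : Type v} [Category.{w} C] [Preadditive C]
    [HasFiniteBiproducts C] [HasBinaryBiproducts C] {n : ℕ} (f : Fin (n + 1) → C) :
    Nonempty ((⨁ f) ≅ f 0 ⊞ ⨁ fun j : Fin n => f j.succ) := by
  refine ⟨⟨biprod.lift (biproduct.π f 0) (biproduct.lift fun j => biproduct.π f j.succ),
    biprod.desc (biproduct.ι f 0) (biproduct.desc fun j => biproduct.ι f j.succ), ?_, ?_⟩⟩
  · rw [biprod.lift_desc, biproduct.lift_desc, ← biproduct.total, Fin.sum_univ_succ]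
  · ext
    · simp
    · rename_i j
      simp [biproduct.ι_π_ne _ (Fin.succ_ne_zero j).symm]
    · rename_i j
      simp [biproduct.ι_π_ne _ (Fin.succ_ne_zero j)]
    · rename_i j j'
      by_cases h : j = j'
      · subst h; simp
      · simp [biproduct.ι_π_ne _ h, biproduct.ι_π_ne f (fun h' => h (Fin.succ_injective _ h'))]

/-! ### Morphism spaces and lengths in a tube -/

section Tube

/-- Within one residue class a number is determined by its quotient by `r`, which is at most `l /
r`. -/
lemma card_filter_natCast_eq_le (r : ℕ) [NeZero r] (l : ℕ) (c : ZMod r) :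
    ((Finset.range (l + 1)).filter fun a : ℕ => (a : ZMod r) = c).card ≤ l / r + 1 := by
  rw [← Finset.card_range (l / r + 1)]
  refine Finset.card_le_card_of_injOn (· / r) (fun a ha => ?_) (fun a ha b hb hab => ?_)
  · simp only [Finset.coe_filter, Finset.mem_range, Set.mem_ofPred_eq] at ha
    simp only [Finset.coe_range, Set.mem_Iio]
    exact Nat.lt_succ_of_le (Nat.div_le_div_right (by omega))
  · simp only [Finset.coe_filter, Set.mem_ofPred_eq] at ha hb
    have h := (ZMod.natCast_eq_natCast_iff' a b r).1 (ha.2.trans hb.2.symm)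
    rw [← Nat.div_add_mod a r, ← Nat.div_add_mod b r, h]
    simp only at hab
    rw [hab]

variable {k : Type u} [Field k] {r : ℕ}
variable {T : Type v} [Category.{w} T] [Preadditive T] [HasZeroObject T] [HasShift T ℤ]
  [∀ n : ℤ, (shiftFunctor T n).Additive] [Pretriangulated T]
variable [Linear k T] {P : ObjectProperty T} (D : TubeData k P r)

namespace TubeData

/-- The coefficients of a morphism that may be non-zero. -/
noncomputable def coeffs (x y : TubeVertex r) :
    (D.φ.obj x ⟶ D.φ.obj y) →ₗ[k]
      (((Finset.range (x.level + 1)).filter fun a : ℕ => (a : ZMod r) = y.ray - x.ray) → k) :=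
  LinearMap.pi fun a => D.coeff a

lemma coeffs_injective (x y : TubeVertex r) : Function.Injective (D.coeffs x y) := by
  rw [← LinearMap.ker_eq_bot, LinearMap.ker_eq_bot']
  intro f hf
  refine D.eq_zero_of_coeff f fun a ha => ?_
  by_cases h : (a : ZMod r) = y.ray - x.ray
  · exact congrFun hf ⟨a, by simp [h]; omega⟩
  · exact D.coeff_eq_zero f fun h' => h (by rw [h'.1]; ring)

lemma finiteDimensional_hom (x y : TubeVertex r) :
    FiniteDimensional k (D.φ.obj x ⟶ D.φ.obj y) :=
  FiniteDimensional.of_injective _ (D.coeffs_injective x y)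

lemma finrank_hom_le (x y : TubeVertex r) :
    Module.finrank k (D.φ.obj x ⟶ D.φ.obj y) ≤ x.level / r + 1 := by
  have : NeZero r := ⟨D.rank_pos.ne'⟩
  refine (LinearMap.finrank_le_finrank_of_injective (D.coeffs_injective x y)).trans ?_
  rw [Module.finrank_fintype_fun_eq_card, Fintype.card_coe]
  exact card_filter_natCast_eq_le r _ _

/-- For each `q ≤ x.level / r`, descending `r * q` steps and climbing back gives a closed path
winding `q` times around the tube. The coefficients at `r * q` separate these paths. -/
lemma le_finrank_end (x : TubeVertex r) :
    x.level / r + 1 ≤ Module.finrank k (D.φ.obj x ⟶ D.φ.obj x) := by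
  have := D.finiteDimensional_hom x x
  have hle (q : Fin (x.level / r + 1)) : r * q ≤ x.level :=
    (Nat.mul_le_mul_left r (Nat.le_of_lt_succ q.2)).trans (Nat.mul_div_le _ _)
  have hp (q : Fin (x.level / r + 1)) : ∃ p : Quiver.Path x x, downs p = r * q := by
    obtain ⟨p, hp⟩ := IsNormalPath.exists_path x (r * q) (r * q) (hle q)
    have h : (⟨x.ray + ((r * q : ℕ) : ZMod r), x.level - r * q + r * q⟩ : TubeVertex r) = x := by
      ext
      · simp
      · exact Nat.sub_add_cancel (hle q)
    revert p
    rw [h]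
    exact fun p hp => ⟨p, hp.downs_eq⟩
  choose p hp using hp
  have hli : LinearIndependent k fun q => D.ofPath (p q) := by
    rw [Fintype.linearIndependent_iff]
    intro g hg q
    have h := congrArg (D.coeff (r * q)) hg
    rw [map_sum, map_zero, Finset.sum_eq_single_of_mem q (Finset.mem_univ q), map_smul,
      coeff_ofPath, if_pos ⟨hp q, hle q⟩, smul_eq_mul] at h
    · have hs : (pathSign (p q) : k) * pathSign (p q) = 1 := by
        exact_mod_cast congrArg (Int.cast : ℤ → k) (pathSign_mul_self (p q))
      rw [← mul_one (g q), ← hs, ← mul_assoc, h, zero_mul]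
    · intro q' _ hq'
      rw [map_smul, coeff_ofPath, if_neg, smul_zero]
      rintro ⟨h, -⟩
      rw [hp, Nat.mul_right_inj D.rank_pos.ne'] at h
      exact hq' (Fin.ext h)
  simpa using hli.fintype_card_le_finrank

/-! ### Monomorphisms and composition lengths in the tube -/

lemma coeff_comp_up (a : ℕ) {x : TubeVertex r} {i : ZMod r} {l : ℕ}
    (f : D.φ.obj x ⟶ D.φ.obj ⟨i, l⟩) :
    D.coeff a (f ≫ D.φ.map (TubeArrow.up i l)) = D.coeff a f := by
  have : D.coeff a ∘ₗ Linear.rightComp k (D.φ.obj x) (D.φ.map (TubeArrow.up i l)) =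
      D.coeff a := by
    refine D.hom_ext fun p => ?_
    rw [LinearMap.comp_apply, Linear.rightComp_apply, ← ofPath_cons, coeff_ofPath, coeff_ofPath]
    simp [downs, pathSign, TubeArrow.downs, TubeArrow.sign]
  exact LinearMap.congr_fun this f

/-- The inclusion of the socle is the path straight up the ray: it has no downward steps and sign
`1`. As its source has level `0`, a composition with it is determined by its coefficient at `0`. -/
lemma exists_socle (i : ZMod r) (m : ℕ) : ∃ ι : D.φ.obj ⟨i, 0⟩ ⟶ D.φ.obj ⟨i, m⟩, ι ≠ 0 ∧
    ∀ (y : TubeVertex r) (f : D.φ.obj ⟨i, m⟩ ⟶ D.φ.obj y), D.coeff 0 (ι ≫ f) = D.coeff 0 f := by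
  obtain ⟨p, hp, hs⟩ : ∃ p : Quiver.Path (⟨i, 0⟩ : TubeVertex r) ⟨i, m⟩,
      downs p = 0 ∧ pathSign p = 1 := by
    induction m with
    | zero => exact ⟨.nil, rfl, rfl⟩
    | succ m ih =>
      obtain ⟨p, hp, hs⟩ := ih
      exact ⟨p.cons (TubeArrow.up i m), by simp [downs, hp, TubeArrow.downs],
        by simp [pathSign, hs, TubeArrow.sign]⟩
  refine ⟨D.ofPath p, fun h => ?_, fun y f => ?_⟩
  · have h' := D.coeff_ofPath 0 p
    rw [h, hp, hs] at h'
    simp at h'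
  · have : D.coeff 0 ∘ₗ Linear.leftComp k (D.φ.obj y) (D.ofPath p) = D.coeff 0 := by
      refine D.hom_ext fun q => ?_
      rw [LinearMap.comp_apply, Linear.leftComp_apply, ← ofPath_comp, coeff_ofPath, coeff_ofPath,
        downs_comp, pathSign_comp, hp, hs]
      simp
    exact LinearMap.congr_fun this f

lemma prop_obj (x : TubeVertex r) : P (D.φ.obj x) :=
  (D.mem_iff _).2 ⟨1, fun _ => x, ⟨(biproductUniqueIso fun _ : Fin 1 => D.φ.obj x).symm⟩⟩

/-- An indecomposable object of the tube as an object of the full subcategory. -/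
abbrev tubeObj (x : TubeVertex r) : P.FullSubcategory := ⟨D.φ.obj x, D.prop_obj x⟩

include D in
lemma eq_zero_of_precomp {X : P.FullSubcategory} {Z : T} (f : X.obj ⟶ Z)
    (hf : ∀ x (h : D.φ.obj x ⟶ X.obj), h ≫ f = 0) : f = 0 := by
  obtain ⟨n, a, ⟨e⟩⟩ := (D.mem_iff X.obj).1 X.property
  rw [← cancel_epi e.inv, comp_zero]
  refine biproduct.hom_ext' _ _ fun j => ?_
  rw [comp_zero, ← Category.assoc, hf]

lemma eq_zero_of_mono {X Y : P.FullSubcategory} (f : X ⟶ Y) [Mono f] {x : TubeVertex r}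
    (h : D.φ.obj x ⟶ X.obj) (hf : h ≫ f.hom = 0) : h = 0 := by
  let h' : D.tubeObj x ⟶ X := ObjectProperty.homMk h
  have : h' = ObjectProperty.homMk 0 := by
    rw [← cancel_mono f]
    ext
    simpa [h'] using hf
  exact congrArg InducedCategory.Hom.hom this

/-- Composition with `g` is injective on the finite-dimensional endomorphism space, hence
surjective, so it hits the identity. -/
lemma isIso_of_mono_end {x : TubeVertex r} (g : D.tubeObj x ⟶ D.tubeObj x) [Mono g] :
    IsIso g := by
  have := D.finiteDimensional_hom x x
  have hinj : Function.Injective (Linear.rightComp k (D.φ.obj x) g.hom) := by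
    rw [← LinearMap.ker_eq_bot, LinearMap.ker_eq_bot']
    exact fun h hh => D.eq_zero_of_mono g h hh
  obtain ⟨h, hh⟩ := LinearMap.surjective_of_injective hinj (𝟙 _)
  let h' : D.tubeObj x ⟶ D.tubeObj x := ObjectProperty.homMk h
  have h₁ : h' ≫ g = 𝟙 _ := by
    ext
    exact hh
  exact ⟨h', by rw [← cancel_mono g, Category.assoc, h₁, Category.comp_id, Category.id_comp], h₁⟩

/-- If the coefficient at `0` vanished, `f` would kill the socle of its source. -/
lemma coeff_zero_ne_zero {z y : TubeVertex r} (f : D.φ.obj z ⟶ D.φ.obj y)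
    (hf : ∀ x (h : D.φ.obj x ⟶ D.φ.obj z), h ≫ f = 0 → h = 0) : D.coeff 0 f ≠ 0 := by
  obtain ⟨ι, hι, hc⟩ := D.exists_socle z.ray z.level
  intro h
  refine hι (hf _ _ (D.eq_zero_of_coeff _ fun a ha => ?_))
  obtain rfl : a = 0 := Nat.le_zero.1 ha
  rw [← h]
  exact hc y f

/-- The subobjects of an indecomposable object in the tube lie on the same ray below it. -/
lemma isZero_or_iso_of_mono {X : P.FullSubcategory} {y : TubeVertex r} (f : X ⟶ D.tubeObj y)
    [Mono f] : IsZero X ∨ ∃ m ≤ y.level, Nonempty (X ≅ D.tubeObj ⟨y.ray, m⟩) := by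
  obtain ⟨n, a, ⟨e⟩⟩ := (D.mem_iff X.obj).1 X.property
  let ι (j : Fin n) : D.φ.obj (a j) ⟶ X.obj := biproduct.ι (fun j => D.φ.obj (a j)) j ≫ e.inv
  let π (j : Fin n) : X.obj ⟶ D.φ.obj (a j) := e.hom ≫ biproduct.π (fun j => D.φ.obj (a j)) j
  have hι (j : Fin n) : ι j ≫ π j = 𝟙 _ := by simp [ι, π]
  -- Each summand of `X` embeds into `y`, so its coefficient at `0` is non-zero; this places it on
  -- the ray of `y`, no higher than `y`.
  have hc (j : Fin n) : D.coeff 0 (ι j ≫ f.hom) ≠ 0 := by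
    refine D.coeff_zero_ne_zero _ fun x h hh => ?_
    have := D.eq_zero_of_mono f (h ≫ ι j) (by simpa using hh)
    rw [← Category.comp_id h, ← hι j, ← Category.assoc, this, zero_comp]
  have ha (j : Fin n) : (a j).ray = y.ray ∧ (a j).level ≤ y.level := by
    by_contra h
    refine hc j (D.coeff_eq_zero _ fun h' => h ?_)
    simpa [eq_comm] using h'
  -- Two summands would have the same socle, and morphisms from it to `y` have only the coefficient
  -- at `0`. Hence a non-trivial combination of the two socle inclusions into `X` is killed by `f`.
  have hn : Subsingleton (Fin n) := by
    refine ⟨fun j j' => ?_⟩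
    by_contra hj
    have hs (j : Fin n) : ∃ ι' : D.φ.obj ⟨y.ray, 0⟩ ⟶ D.φ.obj (a j), ι' ≠ 0 ∧
        ∀ f : D.φ.obj (a j) ⟶ D.φ.obj y, D.coeff 0 (ι' ≫ f) = D.coeff 0 f := by
      obtain ⟨ι', h, h'⟩ := D.exists_socle (a j).ray (a j).level
      rw [← (ha j).1]
      exact ⟨ι', h, h' y⟩
    obtain ⟨σ, hσ, hσc⟩ := hs j
    obtain ⟨σ', hσ', hσc'⟩ := hs j'
    have h := D.eq_zero_of_mono f (D.coeff 0 (ι j' ≫ f.hom) • (σ ≫ ι j) -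
      D.coeff 0 (ι j ≫ f.hom) • (σ' ≫ ι j')) (D.eq_zero_of_coeff _ fun b hb => by
        obtain rfl : b = 0 := Nat.le_zero.1 hb
        have h₁ := hσc (ι j ≫ f.hom)
        have h₂ := hσc' (ι j' ≫ f.hom)
        simp only [Preadditive.sub_comp, Linear.smul_comp, Category.assoc, map_sub, map_smul,
          h₁, h₂, smul_eq_mul]
        ring)
    have h₃ : ι j' ≫ π j = 0 := by
      simp [ι, π, biproduct.ι_π_ne _ (Ne.symm hj)]
    have h₄ := congrArg (· ≫ π j) h
    simp only [Preadditive.sub_comp, Linear.smul_comp, Category.assoc, hι, h₃, comp_zero,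
      smul_zero, sub_zero, zero_comp, Category.comp_id] at h₄
    exact (smul_ne_zero (hc j') hσ) h₄
  rcases isEmpty_or_nonempty (Fin n) with hempty | ⟨⟨j⟩⟩
  · left
    rw [IsZero.iff_id_eq_zero]
    ext
    change 𝟙 X.obj = 0
    rw [← cancel_epi e.inv]
    exact biproduct.hom_ext' _ _ fun j => (hempty.false j).elim
  · right
    refine ⟨(a j).level, (ha j).2, ⟨P.isoMk ?_⟩⟩
    have hπ : π j ≫ ι j = 𝟙 _ := by
      rw [← cancel_epi e.inv, ← cancel_mono e.hom]
      refine biproduct.hom_ext _ _ fun j₁ => biproduct.hom_ext' _ _ fun j₂ => ?_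
      obtain rfl := Subsingleton.elim j j₁
      obtain rfl := Subsingleton.elim j j₂
      simp [ι, π]
    have haj : a j = ⟨y.ray, (a j).level⟩ := TubeVertex.ext (ha j).1 rfl
    exact Iso.mk (π j) (ι j) hπ (hι j) ≪≫ eqToIso (congrArg D.φ.obj haj)

/-- Composition with an upward arrow preserves every coefficient, and the coefficients determine a
morphism. -/
lemma mono_up (i : ZMod r) (l : ℕ) : Mono (ObjectProperty.homMk (D.φ.map (TubeArrow.up i l)) :
    D.tubeObj ⟨i, l⟩ ⟶ D.tubeObj ⟨i, l + 1⟩) := by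
  refine Preadditive.mono_of_cancel_zero _ fun {X} g hg => ?_
  ext
  change g.hom = 0
  replace hg : g.hom ≫ D.φ.map (TubeArrow.up i l) = 0 := congrArg InducedCategory.Hom.hom hg
  refine D.eq_zero_of_precomp _ fun x h => D.eq_zero_of_coeff _ fun a _ => ?_
  rw [← coeff_comp_up, Category.assoc, hg, comp_zero, map_zero]

lemma le_objLength (i : ZMod r) (l : ℕ) : (l : ℕ∞) + 1 ≤ objLength (D.tubeObj ⟨i, l⟩) := by
  induction l with
  | zero =>
    -- The empty biproduct is a zero object of the tube; it is a proper subobject of the object at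
    -- the mouth and starts the chain along the ray.
    let Z : P.FullSubcategory := ⟨⨁ fun j : Fin 0 => D.φ.obj j.elim0, (D.mem_iff _).2
      ⟨0, Fin.elim0, ⟨biproduct.mapIso fun j => j.elim0⟩⟩⟩
    have hZ : 𝟙 Z = 0 := by
      ext j
      exact j.elim0
    have hZ' : IsZero Z := (IsZero.iff_id_eq_zero Z).2 hZ
    have : Mono (0 : Z ⟶ D.tubeObj ⟨i, 0⟩) := ⟨fun _ _ _ => hZ'.eq_of_tgt _ _⟩
    refine (add_le_add_left zero_le 1).trans
      (objLength_add_one_le (0 : Z ⟶ D.tubeObj ⟨i, 0⟩) fun h => (D.indecomposable ⟨i, 0⟩).1 ?_)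
    exact P.ι.map_isZero (hZ'.of_iso (asIso (0 : Z ⟶ D.tubeObj ⟨i, 0⟩)).symm)
  | succ l ih =>
    have := D.mono_up i l
    refine (add_le_add_left ih 1).trans (objLength_add_one_le
      (ObjectProperty.homMk (D.φ.map (TubeArrow.up i l)) :
        D.tubeObj ⟨i, l⟩ ⟶ D.tubeObj ⟨i, l + 1⟩) fun h => ?_)
    have := D.injective ⟨i, l⟩ ⟨i, l + 1⟩ ⟨P.ι.mapIso (asIso
      (ObjectProperty.homMk (D.φ.map (TubeArrow.up i l)) :
        D.tubeObj ⟨i, l⟩ ⟶ D.tubeObj ⟨i, l + 1⟩))⟩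
    simp at this

/-- The ray gives the lower bound. For the upper one, a proper subobject is zero or lies strictly
lower on the ray, because a monomorphism at the same level would be an endomorphism and hence
invertible. -/
lemma objLength_tubeObj (i : ZMod r) (l : ℕ) : objLength (D.tubeObj ⟨i, l⟩) = (l + 1 : ℕ) := by
  refine le_antisymm ?_ (by exact_mod_cast D.le_objLength i l)
  induction l using Nat.strong_induction_on with
  | _ l ih =>
    refine objLength_le _ fun X f _ hf => ?_
    rcases D.isZero_or_iso_of_mono f with hX | ⟨m, hm, ⟨e⟩⟩
    · rw [objLength_eq_zero_of_isZero hX]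
      exact_mod_cast Nat.succ_pos l
    · rw [objLength_eq_of_iso e]
      rcases Nat.lt_or_eq_of_le hm with hm | rfl
      · exact (ih m hm).trans_lt (by exact_mod_cast Nat.succ_lt_succ hm)
      · have : Mono (e.inv ≫ f) := mono_comp _ _
        have := D.isIso_of_mono_end (e.inv ≫ f)
        exact (hf (IsIso.of_isIso_comp_left e.inv f)).elim

lemma exists_iso_of_indecomposable {X : T} (hX : Indecomposable X) (hP : P X) :
    ∃ x, Nonempty (X ≅ D.φ.obj x) := by
  obtain ⟨n, a, ⟨e⟩⟩ := (D.mem_iff X).1 hP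
  cases n with
  | zero =>
    refine (hX.1 ?_).elim
    rw [IsZero.iff_id_eq_zero, ← cancel_epi e.inv]
    exact biproduct.hom_ext' _ _ fun j => j.elim0
  | succ n =>
    obtain ⟨e'⟩ := nonempty_iso_biproduct_succ fun j => D.φ.obj (a j)
    rcases hX.2 _ _ (e ≪≫ e') with h | h
    · exact ((D.indecomposable _).1 h).elim
    · exact ⟨a 0, ⟨e ≪≫ e' ≪≫ (isoBiprodZero h).symm⟩⟩

lemma tubeLength_eq {X : T} (hP : P X) {x : TubeVertex r} (e : X ≅ D.φ.obj x) :
    tubeLength P X hP = (x.level + 1 : ℕ) := by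
  rw [tubeLength, objLength_eq_of_iso (P.isoMk e : (⟨X, hP⟩ : P.FullSubcategory) ≅ D.tubeObj x)]
  exact D.objLength_tubeObj x.ray x.level

end TubeData

end Tube

/-! ### Truncations -/

/-- A morphism from the truncation `tY` of `t` to the co-aisle is zero if its composition with the
truncation morphism `t ⟶ tY` is zero. -/
lemma eq_zero_of_truncation_comp {T : Type v} [Category.{w} T] [Preadditive T] [HasZeroObject T]
    [HasShift T ℤ] [∀ n : ℤ, (shiftFunctor T n).Additive] [Pretriangulated T]
    (τ : Triangulated.TStructure T) {t tX tY Y : T} (htX : τ.le 0 tX) (hY : τ.ge 1 Y)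
    {a : tX ⟶ t} {b : t ⟶ tY} {c : tY ⟶ tX⟦(1 : ℤ)⟧}
    (habc : Pretriangulated.Triangle.mk a b c ∈ Pretriangulated.distinguishedTriangles)
    (f : tY ⟶ Y) (hf : b ≫ f = 0) : f = 0 := by
  -- Exactness factors `f` through the shift of `tX`, which is still in the aisle and so has no
  -- non-zero morphism to `Y`.
  obtain ⟨g, rfl⟩ := Pretriangulated.Triangle.yoneda_exact₃ _ habc f hf
  have h : τ.le (-1) (tX⟦(1 : ℤ)⟧) := τ.le_shift 0 1 (-1) (by norm_num) _ htX
  rw [τ.zero' g (τ.le_monotone (by norm_num) _ h) hY]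
  exact comp_zero

end LengthBound

/-! ### The length bound -/

theorem proposition6p7 {k : Type*} [Field k] [IsAlgClosed k]
    {T : Type*} [Category* T] [Preadditive T] [HasZeroObject T] [HasShift T ℤ]
    [∀ n : ℤ, (shiftFunctor T n).Additive] [Pretriangulated T] [IsTriangulated T] [Linear k T]
    (hT : LengthBound.IsPiecewiseTameHereditary k T)
    (ϱ : ℕ) (hϱ : 1 < ϱ) (𝒯 : ObjectProperty T) (h𝒯 : LengthBound.IsStandardStableTube k 𝒯 ϱ)
    -- the aisle is `X = τ.le 0`, the co-aisle is `Y = τ.ge 1`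
    (τ : Triangulated.TStructure T) (hY : (LengthBound.ind (τ.ge 1 ⊓ 𝒯)).Infinite)
    (t : T) (ht : Indecomposable t) (ht𝒯 : 𝒯 t)
    -- the truncation triangle of `t`
    (tX tY : T) (htX : τ.le 0 tX) (htY : τ.ge 1 tY) (a : tX ⟶ t) (b : t ⟶ tY)
    (c : tY ⟶ tX⟦(1 : ℤ)⟧)
    (habc : Pretriangulated.Triangle.mk a b c ∈ Pretriangulated.distinguishedTriangles)
    -- an indecomposable direct summand of `tY` lying in the tube
    (s : T) (hs : Indecomposable s) (hs𝒯 : 𝒯 s) (hsum : ∃ z : T, Nonempty (tY ≅ s ⊞ z)) :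
    ∃ m n : ℕ, LengthBound.tubeLength 𝒯 t ht𝒯 = m ∧ LengthBound.tubeLength 𝒯 s hs𝒯 = n ∧
      n ≤ ϱ * ⌈(m : ℚ) / ϱ⌉₊ := by

  obtain ⟨D⟩ := h𝒯
  obtain ⟨x, ⟨ex⟩⟩ := D.exists_iso_of_indecomposable ht ht𝒯
  obtain ⟨y, ⟨ey⟩⟩ := D.exists_iso_of_indecomposable hs hs𝒯
  obtain ⟨z, ⟨e⟩⟩ := hsum
  refine ⟨x.level + 1, y.level + 1, D.tubeLength_eq ht𝒯 ex, D.tubeLength_eq hs𝒯 ey, ?_⟩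
  let p : tY ⟶ D.φ.obj y := e.hom ≫ biprod.fst ≫ ey.hom
  let i : D.φ.obj y ⟶ tY := ey.inv ≫ biprod.inl ≫ e.inv
  have hip : i ≫ p = 𝟙 _ := by simp [i, p]
  let L : (D.φ.obj y ⟶ D.φ.obj y) →ₗ[k] (D.φ.obj x ⟶ D.φ.obj y) :=
    Linear.leftComp k _ (ex.inv ≫ b ≫ p)
  have hL : Function.Injective L := by
    rw [← LinearMap.ker_eq_bot, LinearMap.ker_eq_bot']
    intro f hf
    replace hf : (ex.inv ≫ b ≫ p) ≫ f = 0 := hf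
    rw [Category.assoc, Preadditive.IsIso.comp_left_eq_zero] at hf
    -- Extending `f` to the endomorphism `p ≫ f ≫ i` of `tY` makes the target an object known to lie
    -- in the co-aisle.
    have h := LengthBound.eq_zero_of_truncation_comp τ htX htY habc (p ≫ f ≫ i) (by
      rw [Category.assoc] at hf
      rw [reassoc_of% hf, zero_comp])
    calc f = i ≫ (p ≫ f ≫ i) ≫ p := by simp [hip, reassoc_of% hip]
      _ = 0 := by rw [h, zero_comp, comp_zero]
  have := D.finiteDimensional_hom x y
  have h : y.level / ϱ ≤ x.level / ϱ := Nat.le_of_succ_le_succ <|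
    (D.le_finrank_end y).trans
      ((LinearMap.finrank_le_finrank_of_injective hL).trans (D.finrank_hom_le x y))
  -- The shift from level to length turns the floor into a ceiling: `⌊l / ϱ⌋ + 1 = ⌈(l + 1) / ϱ⌉`,
  -- of which only `≤` is needed.
  have hx : x.level / ϱ + 1 ≤ ⌈((x.level + 1 : ℕ) : ℚ) / ϱ⌉₊ := by
    rw [Nat.succ_le_iff, Nat.lt_ceil, lt_div_iff₀ (by exact_mod_cast D.rank_pos)]
    exact_mod_cast Nat.lt_succ_of_le (Nat.div_mul_le_self _ _)
  -- The length `y.level + 1` is at most `ϱ * (y.level / ϱ + 1)`.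
  exact (Nat.lt_mul_div_succ y.level D.rank_pos).trans_le
    (Nat.mul_le_mul_left _ ((Nat.succ_le_succ h).trans hx))
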